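/- Let $q$ be a prime number and let $\omega_q = w_0w_1w_2\cdots$ be the generalized Thue--Morse word over $\{0,1,\dots,q-1\}$: $w_i$ is the sum of the base-$q$ digits of $i$, taken modulo $q$. For integers $c\ge 0$ and $d\ge 1$ let $L_{\omega_q}(c,d)$ be the largest $\ell$ such that $w_c=w_{c+d}=\cdots=w_{c+(\ell-1)d}$, and let $L_{\omega_q}(d)=\max_{c\ge 0} L_{\omega_q}(c,d)$. Then for every integer $n\ge 1$ $$\max_{1\le d<q^n}L_{\omega_q}(d)=\begin{cases} q^n+2q, & n\equiv 0 \pmod q,\\ q^n, & \text{otherwise.}\end{cases}$$ Moreover, in both cases the maximum is reached with the difference $d=q^n-1$, and it is reached there with an initial number $c\ge 1$ (so that the result is the same if only $c\ge 1$ is allowed). -/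

import Mathlib

/-- The generalized Thue-Morse word over the alphabet `ZMod q`, indexed from `0`:
its `i`-th letter is the sum of the base-`q` digits of `i`, reduced modulo `q`. -/
def genThueMorse (q : ℕ) (i : ℕ) : ZMod q :=
  ((Nat.digits q i).sum : ZMod q)

/-- The word `w_c w_{c+d} ⋯ w_{c+(l-1)d}` has all its letters equal. -/
def IsMonochromaticAP {α : Type*} (w : ℕ → α) (c d l : ℕ) : Prop :=
  ∀ i < l, w (c + i * d) = w c

/-- The length of the longest monochromatic arithmetic progression in `w` with initial number `c`
and difference `d` (it is `⊤` when the progression never stops). -/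
noncomputable def apLengthFrom {α : Type*} (w : ℕ → α) (c d : ℕ) : ℕ∞ :=
  ⨆ (l : ℕ) (_ : IsMonochromaticAP w c d l), (l : ℕ∞)

/-- The length of the longest monochromatic arithmetic progression in `w` with difference `d`,
over all initial numbers (it is `⊤` when these lengths are unbounded). -/
noncomputable def maxAPLength {α : Type*} (w : ℕ → α) (d : ℕ) : ℕ∞ :=
  ⨆ c : ℕ, apLengthFrom w c d

/-- The value `q ^ n + 2 * q` when `q` divides `n`, and `q ^ n` otherwise. -/
def apBound (q n : ℕ) : ℕ :=
  if n ≡ 0 [MOD q] then q ^ n + 2 * q else q ^ n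

/-! ### Digit sums modulo `q` and `q`-adic valuations. -/

section DigitSum

variable {q : ℕ}

/-! Let `v` be the `q`-adic valuation. By Legendre's formula the `a`-th letter is `a + v(a!)` mod
`q`, so passing from `a` to `a + 1` adds `1 + v(a + 1)`.

Write a term as `x + q ^ n * y` with `x < q ^ n`. If `x > 0`, adding `q ^ n - 1` gives `(x - 1, y +
1)` and keeps the letter iff `v(x) ≡ v(y + 1)` mod `q`. This is automatic when `q ^ n ∣ x + y + 1`,
whence length `q ^ n`. At `x = 0` the letter changes by `-n`, so only `q ∣ n` allows longer
progressions; `IsMonochromaticAP.le_of_pow_sub_one` and `isMonochromaticAP_pow_add_two_mul` show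
that the gain is exactly `2 * q`.

If `q ∤ d`, then `q ^ n` steps meet every residue `x`, which forces `d = q ^ n - 1` and `q ∣ n`
(`eq_pow_sub_one_of_isMonochromaticAP`). If `q ∣ d`, dividing by `q` gives an induction on `n`. -/

theorem genThueMorse_add_mul (hq : 1 < q) {r : ℕ} (hr : r < q) (b : ℕ) :
    genThueMorse q (r + q * b) = r + genThueMorse q b := by
  unfold genThueMorse
  rcases Nat.eq_zero_or_pos (r + q * b) with h | h
  · have h1 : r = 0 := by omega
    have h2 : b = 0 := by
      have : q * b = 0 := by omega
      rcases Nat.mul_eq_zero.1 this with h | h <;> omega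
    simp [h1, h2]
  · rw [Nat.digits_def' hq h, Nat.add_mul_mod_self_left, Nat.mod_eq_of_lt hr,
      Nat.add_mul_div_left _ _ (by omega), Nat.div_eq_of_lt hr, zero_add, List.sum_cons]
    push_cast
    rfl

theorem genThueMorse_of_lt (hq : 1 < q) {r : ℕ} (hr : r < q) : genThueMorse q r = r := by
  have := genThueMorse_add_mul hq hr 0
  simpa [genThueMorse] using this

theorem genThueMorse_add_pow_mul (hq : 1 < q) (k : ℕ) :
    ∀ {a : ℕ}, a < q ^ k → ∀ b : ℕ,
      genThueMorse q (a + q ^ k * b) = genThueMorse q a + genThueMorse q b := by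
  induction k with
  | zero =>
    intro a ha b
    have : a = 0 := by simpa using ha
    simp [this, genThueMorse]
  | succ k ih =>
    intro a ha b
    have hlt : a % q < q := Nat.mod_lt _ (by omega)
    have h1 : a + q ^ (k + 1) * b = a % q + q * (a / q + q ^ k * b) := by
      conv_lhs => rw [← Nat.mod_add_div a q]
      ring
    have h2 : a / q < q ^ k := by
      rw [Nat.div_lt_iff_lt_mul (by omega), ← pow_succ]; exact ha
    rw [h1, genThueMorse_add_mul hq hlt, ih h2]
    conv_rhs => rw [← Nat.mod_add_div a q, genThueMorse_add_mul hq hlt]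
    ring

variable [Fact q.Prime]

theorem genThueMorse_eq_add_padicValNat_factorial (a : ℕ) :
    genThueMorse q a = (a + padicValNat q a.factorial : ZMod q) := by
  have h := sub_one_mul_padicValNat_factorial (p := q) a
  have hle := Nat.digit_sum_le q a
  have hq : 1 ≤ q := (Fact.out : q.Prime).one_lt.le
  have h' := congrArg (Nat.cast : ℕ → ZMod q) h
  rw [Nat.cast_mul, Nat.cast_sub hq, Nat.cast_sub hle, ZMod.natCast_self] at h'
  unfold genThueMorse
  push_cast at h' ⊢
  linear_combination h'

theorem genThueMorse_succ (a : ℕ) :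
    genThueMorse q (a + 1) = genThueMorse q a + 1 + (padicValNat q (a + 1) : ZMod q) := by
  rw [genThueMorse_eq_add_padicValNat_factorial, genThueMorse_eq_add_padicValNat_factorial,
    Nat.factorial_succ, padicValNat.mul (by omega) (Nat.factorial_ne_zero a)]
  push_cast
  ring

theorem genThueMorse_pow_sub_one (n : ℕ) : genThueMorse q (q ^ n - 1) = -(n : ZMod q) := by
  have hq : 1 < q := (Fact.out : q.Prime).one_lt
  have h1 := genThueMorse_succ (q := q) (q ^ n - 1)
  have hpos : 0 < q ^ n := by positivity
  rw [Nat.sub_add_cancel hpos, padicValNat.prime_pow] at h1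
  have h2 := genThueMorse_add_pow_mul hq n hpos 1
  rw [zero_add, mul_one, h1, genThueMorse_of_lt hq hq,
    genThueMorse_of_lt hq (show 0 < q by omega)] at h2
  push_cast at h2
  linear_combination h2

theorem padicValNat_eq_of_pow_dvd_add {n a b : ℕ} (h : q ^ n ∣ a + b) (ha : ¬ q ^ n ∣ a) :
    padicValNat q a = padicValNat q b := by
  have hb : ¬ q ^ n ∣ b := fun hb => ha ((Nat.dvd_add_left hb).1 h)
  have ha0 : a ≠ 0 := by rintro rfl; simp at ha
  have hb0 : b ≠ 0 := by rintro rfl; simp at hb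
  have hk : ∀ k, q ^ k ∣ a ↔ q ^ k ∣ b := by
    intro k
    rcases le_total k n with hkn | hkn
    · have : q ^ k ∣ a + b := (pow_dvd_pow q hkn).trans h
      exact ⟨fun H => (Nat.dvd_add_right H).1 this, fun H => (Nat.dvd_add_left H).1 this⟩
    · exact ⟨fun H => absurd ((pow_dvd_pow q hkn).trans H) ha,
        fun H => absurd ((pow_dvd_pow q hkn).trans H) hb⟩
  apply le_antisymm
  · exact (padicValNat_dvd_iff_le hb0).1 ((hk _).1 pow_padicValNat_dvd)
  · exact (padicValNat_dvd_iff_le ha0).1 ((hk _).2 pow_padicValNat_dvd)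

theorem padicValNat_cast_eq_zero {a : ℕ} (h : ¬ q ∣ a) : (padicValNat q a : ZMod q) = 0 := by
  rw [padicValNat.eq_zero_of_not_dvd h, Nat.cast_zero]

theorem dvd_of_padicValNat_cast_ne_zero {a : ℕ} (h : (padicValNat q a : ZMod q) ≠ 0) : q ∣ a :=
  not_not.1 fun h' => h (padicValNat_cast_eq_zero h')

theorem natCast_ne_zero_of_pos_of_lt {a : ℕ} (h0 : 0 < a) (h : a < q) : (a : ZMod q) ≠ 0 := by
  rw [Ne, ZMod.natCast_eq_zero_iff]
  exact Nat.not_dvd_of_pos_of_lt h0 h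

end DigitSum

/-! ### Monochromatic progressions. -/

section Progressions

variable {q : ℕ}

theorem pow_le_apBound (n : ℕ) : q ^ n ≤ apBound q n := by
  unfold apBound; split_ifs <;> omega

theorem IsMonochromaticAP.eq_succ {α : Type*} {w : ℕ → α} {c d l : ℕ}
    (h : IsMonochromaticAP w c d l) {i : ℕ} (hi : i + 1 < l) :
    w (c + i * d) = w (c + i * d + d) := by
  rw [h i (by omega), ← h (i + 1) hi]
  congr 1
  ring

theorem isMonochromaticAP_of_eq_succ {α : Type*} {w : ℕ → α} {c d l : ℕ}
    (h : ∀ i, i + 1 < l → w (c + i * d) = w (c + i * d + d)) : IsMonochromaticAP w c d l := by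
  intro i
  induction i with
  | zero => intro _; simp
  | succ i ih =>
    intro hi
    rw [← ih (by omega), h i hi]
    congr 1
    ring

theorem IsMonochromaticAP.of_le {α : Type*} {w : ℕ → α} {c d l l' : ℕ}
    (h : IsMonochromaticAP w c d l) (hl : l' ≤ l) : IsMonochromaticAP w c d l' :=
  fun i hi => h i (hi.trans_le hl)

theorem IsMonochromaticAP.div_base (hq : 1 < q) {c d l : ℕ}
    (h : IsMonochromaticAP (genThueMorse q) c (q * d) l) :
    IsMonochromaticAP (genThueMorse q) (c / q) d l := by
  intro i hi
  have hlt : c % q < q := Nat.mod_lt _ (by omega)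
  have h1 := h i hi
  have h2 : c + i * (q * d) = c % q + q * (c / q + i * d) := by
    conv_lhs => rw [← Nat.mod_add_div c q]
    ring
  have h3 : genThueMorse q c = (c % q : ℕ) + genThueMorse q (c / q) := by
    conv_lhs => rw [← Nat.mod_add_div c q, genThueMorse_add_mul hq hlt]
  rw [h2, genThueMorse_add_mul hq hlt, h3] at h1
  exact add_left_cancel h1

theorem exists_lt_mod_eq {Q d : ℕ} (hd : d.Coprime Q) (c : ℕ) {t : ℕ} (ht : t < Q) :
    ∃ i < Q, (c + i * d) % Q = t := by
  have hQ : NeZero Q := ⟨by omega⟩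
  let u := ZMod.unitOfCoprime d hd
  refine ⟨(((t : ZMod Q) - c) * (u⁻¹ : (ZMod Q)ˣ)).val, ZMod.val_lt _, ?_⟩
  conv_rhs => rw [← Nat.mod_eq_of_lt ht]
  change _ ≡ _ [MOD Q]
  rw [← ZMod.natCast_eq_natCast_iff]
  push_cast
  rw [ZMod.natCast_val, ZMod.cast_id, ← ZMod.coe_unitOfCoprime d hd, mul_assoc, Units.inv_mul]
  ring

variable [Fact q.Prime]

/-- One step of a progression with difference `q ^ n - 1` whose low part does not vanish. -/
theorem genThueMorse_eq_add_pow_sub_one_iff {n x y : ℕ} (hx : 0 < x) (hxn : x < q ^ n) :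
    genThueMorse q (x + q ^ n * y) = genThueMorse q (x + q ^ n * y + (q ^ n - 1)) ↔
      (padicValNat q x : ZMod q) = padicValNat q (y + 1) := by
  have hq : 1 < q := (Fact.out : q.Prime).one_lt
  obtain ⟨x, rfl⟩ := Nat.exists_eq_add_of_lt hx
  rw [zero_add] at *
  have h1 : x + 1 + q ^ n * y + (q ^ n - 1) = x + q ^ n * (y + 1) := by
    rw [mul_add]; omega
  rw [h1, genThueMorse_add_pow_mul hq n hxn, genThueMorse_add_pow_mul hq n (by omega),
    genThueMorse_succ, genThueMorse_succ]
  constructor <;> intro h <;> linear_combination h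

theorem IsMonochromaticAP.padicValNat_eq {n c l i x y : ℕ}
    (h : IsMonochromaticAP (genThueMorse q) c (q ^ n - 1) l) (hi : i + 1 < l)
    (hx : 0 < x) (hxn : x < q ^ n) (hxy : c + i * (q ^ n - 1) = x + q ^ n * y) :
    (padicValNat q x : ZMod q) = padicValNat q (y + 1) := by
  have := h.eq_succ hi
  rwa [hxy, genThueMorse_eq_add_pow_sub_one_iff hx hxn] at this

/-! ### Upper bound for the difference `q ^ n - 1`. -/

theorem padicValNat_pow_sub_self_cast_ne_zero {n : ℕ} (hn : 2 ≤ n) :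
    (padicValNat q (q ^ n - q) : ZMod q) ≠ 0 := by
  have hq : 1 < q := (Fact.out : q.Prime).one_lt
  have hlt : q ^ 1 < q ^ n := Nat.pow_lt_pow_right hq (by omega)
  have hdvd : q ^ 2 ∣ (q ^ n - q) + q := by
    rw [Nat.sub_add_cancel (by simpa using hlt.le)]; exact pow_dvd_pow q hn
  have hnd : ¬ q ^ 2 ∣ q := Nat.not_dvd_of_pos_of_lt (by omega) (by nlinarith)
  rw [← padicValNat_eq_of_pow_dvd_add (by rwa [add_comm] at hdvd) hnd, padicValNat.self hq]
  have : Fact (1 < q) := ⟨hq⟩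
  simp

/-- Call a pass of `x` down to `0` aligned if `q ∣ x + y + 1`. Low parts `q` and `q ^ n - q` have
valuation nonzero mod `q`, so they can take a step only in an aligned pass. Each passage through `0`
lowers `x + y` by one mod `q`, so the neighbours of an aligned pass are not aligned and contribute
at most `q` terms each. -/
theorem IsMonochromaticAP.le_of_pow_sub_one {n c l : ℕ} (hn : 2 ≤ n)
    (h : IsMonochromaticAP (genThueMorse q) c (q ^ n - 1) l) : l ≤ q ^ n + 2 * q := by
  have hq : 1 < q := (Fact.out : q.Prime).one_lt
  by_contra! hl
  have hlt : q ^ 1 < q ^ n := Nat.pow_lt_pow_right hq (by omega)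
  rw [pow_one] at hlt
  have hqQ : q ∣ q ^ n := dvd_pow_self q (by omega)
  have hv := padicValNat_pow_sub_self_cast_ne_zero (q := q) hn
  have hc := Nat.mod_add_div c (q ^ n)
  have hx := Nat.mod_lt c (show 0 < q ^ n by omega)
  have key : ∀ i x y, i + 1 < l → 0 < x → x < q ^ n →
      c + i * (q ^ n - 1) = x + q ^ n * y → (padicValNat q x : ZMod q) = padicValNat q (y + 1) :=
    fun i x y hi hx hxn hxy => h.padicValNat_eq hi hx hxn hxy
  generalize c % q ^ n = x at *
  generalize c / q ^ n = y at *
  generalize q ^ n = Q at *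
  obtain ⟨R, rfl⟩ := Nat.exists_eq_add_of_lt hlt
  have e1 : q + R + 1 - 1 = q + R := by omega
  have e2 : q + R + 1 - q = R + 1 := by omega
  rw [e1] at key
  rw [e2] at hv
  -- The second pass reaches low part `q ^ n - q`, so it is aligned.
  have hxy : q ∣ x + y := by
    have h1 := key (x + q) (R + 1) (x + y + q - 1) (by omega) (by omega) (by omega) (by
      obtain ⟨q, rfl⟩ := Nat.exists_eq_add_of_lt hq
      have : x + y + (1 + q + 1) - 1 = x + y + q + 1 := by omega
      rw [← hc, this]; ring)
    rw [h1] at hv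
    have h2 := dvd_of_padicValNat_cast_ne_zero hv
    rw [show x + y + q - 1 + 1 = x + y + q by omega] at h2
    simpa using h2
  have hxq : x < q := by
    by_contra! hxq
    obtain ⟨z, rfl⟩ := Nat.exists_eq_add_of_le hxq
    have h1 := key z q (y + z) (by omega) (by omega) (by omega) (by rw [← hc]; ring)
    rw [padicValNat.self hq, padicValNat_cast_eq_zero] at h1
    · have : Fact (1 < q) := ⟨hq⟩
      simp at h1
    · intro h2
      have h3 : q ∣ y + z := by
        have : q + z + y = q + (y + z) := by ring
        rw [this] at hxy
        simpa using hxy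
      have := (Nat.dvd_add_right h3).1 h2
      have := Nat.le_of_dvd one_pos this
      omega
  -- The same low part one pass later, where alignment fails.
  have h1 := key (x + (q + R + 1) + q) (R + 1) (x + y + (q + R + 1) + q - 2)
    (by omega) (by omega) (by omega) (by
      obtain ⟨q, rfl⟩ := Nat.exists_eq_add_of_lt hq
      have : x + y + (1 + q + 1 + R + 1) + (1 + q + 1) - 2 = x + y + (1 + q + 1 + R + 1) + q := by
        omega
      rw [← hc, this]; ring)
  rw [h1] at hv
  have h2 := dvd_of_padicValNat_cast_ne_zero hv
  have h3 : q ∣ x + y + (q + R + 1) + q := (hxy.add hqQ).add dvd_rfl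
  have h4 := Nat.dvd_sub h3 h2
  have := Nat.le_of_dvd (by omega) h4
  omega

/-- One step of a progression with difference `q ^ n - e` whose low part is at least `e`. -/
theorem genThueMorse_add_pow_sub {n x y e : ℕ} (hen : e ≤ q ^ n) (hx : e ≤ x) (hxn : x < q ^ n)
    (h : genThueMorse q (x + q ^ n * y) = genThueMorse q (x + q ^ n * y + (q ^ n - e))) :
    genThueMorse q x = genThueMorse q (x - e) + 1 + padicValNat q (y + 1) := by
  have hq : 1 < q := (Fact.out : q.Prime).one_lt
  have h1 : x + q ^ n * y + (q ^ n - e) = (x - e) + q ^ n * (y + 1) := by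
    rw [mul_add]; omega
  rw [h1, genThueMorse_add_pow_mul hq n hxn, genThueMorse_add_pow_mul hq n (by omega),
    genThueMorse_succ] at h
  linear_combination h

/-! ### Excluding the other differences prime to `q`. -/

/-- Each step lowers the low part by `e`, the first with a borrow, the second without. Digit sums
then give `v(y + 1) ≡ e` and `v(y + 2) ≡ e - 1`, both nonzero mod `q`, so `q` would divide two
consecutive integers. -/
theorem false_of_two_steps {n k e y N : ℕ} (hn : 2 ≤ n) (he : 2 ≤ e) (heq : e < q)
    (hk : k + 1 < q) (hk2 : k < 2) (hN : N = (k + 1) * q + (e - 1) + q ^ n * y)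
    (h1 : genThueMorse q N = genThueMorse q (N + (q ^ n - e)))
    (h2 : genThueMorse q (N + (q ^ n - e)) =
      genThueMorse q (N + (q ^ n - e) + (q ^ n - e))) : False := by
  have hq : 1 < q := (Fact.out : q.Prime).one_lt
  have hQ : q ^ 2 ≤ q ^ n := Nat.pow_le_pow_right (by omega) hn
  have hk' : (k + 1) * q ≤ 2 * q := Nat.mul_le_mul_right _ (by omega)
  have hkq : (k + 1) * q = k * q + q := by ring
  have hQ3 : 3 * q ≤ q ^ n := by nlinarith
  have hN1 : N + (q ^ n - e) = (k * q + (q - 1)) + q ^ n * (y + 1) := by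
    rw [hN, mul_add]; omega
  have s1 := genThueMorse_add_pow_sub (q := q) (x := (k + 1) * q + (e - 1)) (y := y) (e := e) (n := n)
    (by omega) (by omega) (by omega) (by rw [← hN]; exact h1)
  have s2 := genThueMorse_add_pow_sub (q := q) (x := k * q + (q - 1)) (y := y + 1) (e := e) (n := n)
    (by omega) (by omega) (by omega) (by rw [← hN1]; exact h2)
  have f : ∀ a r, a < q → r < q → genThueMorse q (a * q + r) = r + a := by
    intro a r ha hr
    rw [show a * q + r = r + q * a by ring, genThueMorse_add_mul hq hr, genThueMorse_of_lt hq ha]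
  rw [show (k + 1) * q + (e - 1) - e = k * q + (q - 1) by omega,
    f _ _ hk (by omega), f _ _ (by omega) (by omega)] at s1
  rw [show k * q + (q - 1) - e = k * q + (q - 1 - e) by omega,
    f _ _ (by omega) (by omega), f _ _ (by omega) (by omega)] at s2
  obtain ⟨b, rfl⟩ := Nat.exists_eq_add_of_lt heq
  obtain ⟨a, rfl⟩ := Nat.exists_eq_add_of_le he
  generalize hp : 2 + a + b + 1 = p at *
  have hp0 : (2 + a + b + 1 : ZMod p) = 0 := by
    have := (congrArg (Nat.cast : ℕ → ZMod p) hp).trans (ZMod.natCast_self p)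
    push_cast at this
    exact this
  rw [show 2 + a - 1 = a + 1 by omega, show p - 1 = a + b + 2 by omega] at s1
  rw [show p - 1 = a + b + 2 by omega, show a + b + 2 - (2 + a) = b by omega] at s2
  push_cast at s1 s2
  have d1 : p ∣ y + 1 := by
    apply dvd_of_padicValNat_cast_ne_zero
    have : (padicValNat p (y + 1) : ZMod p) = ((a + 2 : ℕ) : ZMod p) := by
      push_cast
      linear_combination -s1 - hp0
    rw [this]
    exact natCast_ne_zero_of_pos_of_lt (by omega) (by omega)
  have d2 : p ∣ y + 1 + 1 := by
    apply dvd_of_padicValNat_cast_ne_zero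
    have : (padicValNat p (y + 1 + 1) : ZMod p) = ((a + 1 : ℕ) : ZMod p) := by
      push_cast
      linear_combination -s2
    rw [this]
    exact natCast_ne_zero_of_pos_of_lt (by omega) (by omega)
  have := Nat.le_of_dvd one_pos ((Nat.dvd_add_right d1).1 d2)
  omega

/-- The steps visit every residue mod `q ^ n`; the one at residue `x` has no carry into the high
part, which cancels. -/
theorem genThueMorse_add_eq_of_isMonochromaticAP {n c d : ℕ} (hd : d.Coprime (q ^ n))
    (h : IsMonochromaticAP (genThueMorse q) c d (q ^ n + 1)) {x : ℕ} (hx : x + d < q ^ n) :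
    genThueMorse q (x + d) = genThueMorse q x := by
  have hq : 1 < q := (Fact.out : q.Prime).one_lt
  obtain ⟨i, hi, hix⟩ := exists_lt_mod_eq hd c (show x < q ^ n by omega)
  have h1 := h.eq_succ (i := i) (by omega)
  rw [← Nat.mod_add_div (c + i * d) (q ^ n), hix, add_right_comm,
    genThueMorse_add_pow_mul hq n (by omega), genThueMorse_add_pow_mul hq n hx] at h1
  exact (add_right_cancel h1).symm

/-- Otherwise `x = q - 1` and `x = q` are both carry-free, yet the letter grows by `2` from `q - 1`
to `q` and by `1` from `q - 1 + d` to `q + d`. -/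
theorem pow_lt_add_of_isMonochromaticAP {n c d : ℕ} (hd : ¬ q ∣ d)
    (h : IsMonochromaticAP (genThueMorse q) c d (q ^ n + 1)) : q ^ n ≤ d + q := by
  have hp : q.Prime := Fact.out
  by_contra! hlt
  have hcop : d.Coprime (q ^ n) := ((hp.coprime_iff_not_dvd.2 hd).symm).pow_right n
  have h1 := genThueMorse_add_eq_of_isMonochromaticAP hcop h (x := q - 1) (by omega)
  have h2 := genThueMorse_add_eq_of_isMonochromaticAP hcop h (x := q - 1 + 1)
    (by have := hp.pos; omega)
  rw [show q - 1 + 1 + d = q - 1 + d + 1 by omega, genThueMorse_succ, genThueMorse_succ, h1,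
    show q - 1 + 1 = q from Nat.sub_add_cancel hp.pos, padicValNat.self hp.one_lt,
    padicValNat_cast_eq_zero] at h2
  · have : Fact (1 < q) := ⟨hp.one_lt⟩
    simp at h2
  · rw [show q - 1 + d + 1 = d + q by have := hp.pos; omega]
    simpa using hd

theorem eq_pow_sub_one_of_isMonochromaticAP {n c d : ℕ} (hn : 1 ≤ n) (hd : ¬ q ∣ d)
    (hdn : d < q ^ n) (h : IsMonochromaticAP (genThueMorse q) c d (q ^ n + 1)) :
    d = q ^ n - 1 ∧ q ∣ n := by
  have hp : q.Prime := Fact.out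
  have hcop : d.Coprime (q ^ n) := ((hp.coprime_iff_not_dvd.2 hd).symm).pow_right n
  have hs : genThueMorse q d = 0 := by
    have := genThueMorse_add_eq_of_isMonochromaticAP hcop h (x := 0) (by omega)
    rw [zero_add] at this
    rw [this]
    simp [genThueMorse]
  have hn2 : 2 ≤ n := by
    by_contra! hn2
    obtain rfl : n = 1 := by omega
    rw [pow_one] at hdn
    rw [genThueMorse_of_lt hp.one_lt hdn, ZMod.natCast_eq_zero_iff] at hs
    exact hd hs
  have hle := pow_lt_add_of_isMonochromaticAP hd h
  obtain ⟨e, he⟩ : ∃ e, q ^ n = d + e := Nat.exists_eq_add_of_le hdn.le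
  have hqe : ¬ q ∣ e := fun H =>
    hd ((Nat.dvd_add_left H).1 (he ▸ dvd_pow_self q (show n ≠ 0 by omega)))
  have heq : e < q := lt_of_le_of_ne (by omega) (by rintro rfl; exact hqe dvd_rfl)
  have hde : d = q ^ n - e := by omega
  have he1 : e = 1 := by
    by_contra he1
    have he2 : 2 ≤ e := by omega
    have hQ : q ^ 2 ≤ q ^ n := Nat.pow_le_pow_right hp.pos hn2
    have hQ3 : 3 * q ≤ q ^ n := by nlinarith
    -- Two candidate residues: only the index `q ^ n - 1` lacks a second step, and it cannot serve
    -- both.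
    obtain ⟨i, hi, hix⟩ := exists_lt_mod_eq hcop c
      (show (0 + 1) * q + (e - 1) < q ^ n by omega)
    obtain ⟨j, hj, hjx⟩ := exists_lt_mod_eq hcop c
      (show (1 + 1) * q + (e - 1) < q ^ n by omega)
    have fin : ∀ m k, k < 2 → m + 2 < q ^ n + 1 →
        (c + m * d) % q ^ n = (k + 1) * q + (e - 1) → False := by
      intro m k hk hm hmx
      have h1 := h.eq_succ (i := m) (by omega)
      have h2 := h.eq_succ (i := m + 1) (by omega)
      rw [add_mul, one_mul, ← add_assoc] at h2
      have hdiv := Nat.mod_add_div (c + m * d) (q ^ n)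
      rw [hmx] at hdiv
      generalize c + m * d = N at *
      rw [hde] at h1 h2
      exact false_of_two_steps hn2 he2 heq (by omega) hk hdiv.symm h1 h2
    by_cases hi' : i + 2 < q ^ n + 1
    · exact fin i 0 (by omega) hi' hix
    · refine fin j 1 (by omega) ?_ hjx
      have : i ≠ j := by
        rintro rfl
        have := hp.pos
        omega
      omega
  subst he1
  refine ⟨hde, ?_⟩
  rw [hde, genThueMorse_pow_sub_one, neg_eq_zero, ZMod.natCast_eq_zero_iff] at hs
  exact hs

/-! ### Upper bound for all differences. -/

theorem apBound_le_pow_succ {n : ℕ} (hn : 1 ≤ n) : apBound q n ≤ q ^ (n + 1) := by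
  have hq : 1 < q := (Fact.out : q.Prime).one_lt
  unfold apBound
  split_ifs with h
  · have hqn : q ≤ n := Nat.le_of_dvd hn ((Nat.modEq_zero_iff_dvd).1 h)
    have : q ^ 2 ≤ q ^ n := Nat.pow_le_pow_right (by omega) (by omega)
    rw [pow_succ]
    nlinarith
  · exact Nat.pow_le_pow_right (by omega) (by omega)

theorem IsMonochromaticAP.le_apBound {n : ℕ} (hn : 1 ≤ n) : ∀ {c d l : ℕ}, 1 ≤ d → d < q ^ n →
    IsMonochromaticAP (genThueMorse q) c d l → l ≤ apBound q n := by
  have hp : q.Prime := Fact.out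
  induction n, hn using Nat.le_induction with
  | base =>
    intro c d l hd hdn h
    by_contra! hl
    have hb := pow_le_apBound (q := q) 1
    have hqd : ¬ q ∣ d := Nat.not_dvd_of_pos_of_lt hd (by simpa using hdn)
    have := (eq_pow_sub_one_of_isMonochromaticAP le_rfl hqd hdn (h.of_le (by omega))).2
    exact hp.one_lt.ne' (Nat.dvd_one.1 this)
  | succ n hn ih =>
    intro c d l hd hdn h
    by_cases hqd : q ∣ d
    · obtain ⟨d, rfl⟩ := hqd
      have h1 := ih (Nat.pos_of_mul_pos_left hd)
        (by rw [pow_succ'] at hdn; exact Nat.lt_of_mul_lt_mul_left hdn) (h.div_base hp.one_lt)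
      exact h1.trans ((apBound_le_pow_succ hn).trans (pow_le_apBound _))
    · by_contra! hl
      have hb := pow_le_apBound (q := q) (n + 1)
      obtain ⟨rfl, hqn⟩ :=
        eq_pow_sub_one_of_isMonochromaticAP (by omega) hqd hdn (h.of_le (by omega))
      have := h.le_of_pow_sub_one (by omega)
      rw [apBound, if_pos ((Nat.modEq_zero_iff_dvd).2 hqn)] at hl
      omega

/-! ### Progressions attaining the bound. -/

theorem isMonochromaticAP_pow_sub_one (n : ℕ) :
    IsMonochromaticAP (genThueMorse q) (q ^ n - 1) (q ^ n - 1) (q ^ n) := by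
  refine isMonochromaticAP_of_eq_succ fun i hi => ?_
  obtain ⟨k, hk⟩ := Nat.exists_eq_add_of_lt hi
  have h1 : q ^ n - 1 + i * (q ^ n - 1) = (k + 1) + q ^ n * i := by
    rw [hk, show i + 1 + k + 1 - 1 = i + 1 + k by omega]; ring
  rw [h1, genThueMorse_eq_add_pow_sub_one_iff (by omega) (by omega),
    padicValNat_eq_of_pow_dvd_add (n := n) (b := i + 1)]
  · rw [hk]; exact dvd_of_eq (by ring)
  · exact Nat.not_dvd_of_pos_of_lt (by omega) (by omega)

theorem genThueMorse_pow_mul_add_pow_sub_one {n : ℕ} (hqn : q ∣ n) (y : ℕ) :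
    genThueMorse q (q ^ n * y) = genThueMorse q (q ^ n * y + (q ^ n - 1)) := by
  have hp : q.Prime := Fact.out
  have hpos : 0 < q ^ n := pow_pos hp.pos n
  rw [add_comm, genThueMorse_add_pow_mul hp.one_lt n (by omega), genThueMorse_pow_sub_one,
    (ZMod.natCast_eq_zero_iff n q).2 hqn]
  simpa [genThueMorse] using genThueMorse_add_pow_mul hp.one_lt n hpos y

theorem padicValNat_pow_mul_cast_eq_zero {n m : ℕ} (hqn : q ∣ n) (hm : ¬ q ∣ m) :
    (padicValNat q (q ^ n * m) : ZMod q) = 0 := by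
  have hp : q.Prime := Fact.out
  have hm0 : m ≠ 0 := by rintro rfl; simp at hm
  rw [padicValNat.mul (pow_ne_zero n hp.ne_zero) hm0, padicValNat.prime_pow,
    padicValNat.eq_zero_of_not_dvd hm, add_zero]
  exact (ZMod.natCast_eq_zero_iff n q).2 hqn

/-- The start has `x + y = (q ^ q - 1) * q ^ n`, which aligns the middle pass modulo `q ^ n`. In the
two short outer passes nonzero low parts have valuation `0`, while `y + 1` meets the multiples `(q ^
q - 1) * q ^ n` and `q ^ q * q ^ n`; the factor `q ^ q` makes their valuations `n` and `n + q`, both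
`0` mod `q`. -/
theorem isMonochromaticAP_pow_add_two_mul {n : ℕ} (hn : 1 ≤ n) (hqn : q ∣ n) :
    IsMonochromaticAP (genThueMorse q) (q - 1 + q ^ n * ((q ^ q - 1) * q ^ n - (q - 1)))
      (q ^ n - 1) (q ^ n + 2 * q) := by
  have hp : q.Prime := Fact.out
  have hq := hp.one_lt
  have hn2 : 2 ≤ n := (Nat.succ_le_of_lt hq).trans (Nat.le_of_dvd hn hqn)
  have hlt : q ^ 1 < q ^ n := Nat.pow_lt_pow_right hq (by omega)
  rw [pow_one] at hlt
  have hqQ : q ∣ q ^ n := dvd_pow_self q (by omega)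
  have hM : q ≤ q ^ q := Nat.le_self_pow (by omega) q
  have hqM : q ∣ q ^ q := dvd_pow_self q (by omega)
  have hqM1 : ¬ q ∣ q ^ q - 1 := by
    intro H
    have := Nat.dvd_sub hqM H
    rw [show q ^ q - (q ^ q - 1) = 1 by omega] at this
    exact hq.ne' (Nat.dvd_one.1 this)
  have v1 := padicValNat_pow_mul_cast_eq_zero hqn hqM1
  have v2 : (padicValNat q (q ^ n * q ^ q) : ZMod q) = 0 := by
    rw [← pow_add, padicValNat.prime_pow]
    exact (ZMod.natCast_eq_zero_iff _ q).2 (hqn.add dvd_rfl)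
  have vz : ∀ b z, q ∣ b → 0 < z → z < q → (padicValNat q (b + z) : ZMod q) = 0 := by
    intro b z hb hz hzq
    refine padicValNat_cast_eq_zero fun H => ?_
    exact Nat.not_dvd_of_pos_of_lt hz hzq ((Nat.dvd_add_right hb).1 H)
  have vz' : ∀ b z, q ∣ b + z → 0 < z → z < q → (padicValNat q b : ZMod q) = 0 := by
    intro b z hb hz hzq
    refine padicValNat_cast_eq_zero fun H => ?_
    exact Nat.not_dvd_of_pos_of_lt hz hzq ((Nat.dvd_add_right H).1 hb)
  have hstep : ∀ N x y, x < q ^ n → N = x + q ^ n * y →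
      (0 < x → (padicValNat q x : ZMod q) = padicValNat q (y + 1)) →
      genThueMorse q N = genThueMorse q (N + (q ^ n - 1)) := by
    rintro N x y hx rfl hv
    rcases Nat.eq_zero_or_pos x with rfl | hx0
    · rw [zero_add]; exact genThueMorse_pow_mul_add_pow_sub_one hqn y
    · rw [genThueMorse_eq_add_pow_sub_one_iff hx0 hx]; exact hv hx0
  have vsum : ∀ a b, 0 < a → a < q ^ n → q ^ n ∣ a + b →
      (padicValNat q a : ZMod q) = padicValNat q b := fun a b ha han hab => by
    rw [padicValNat_eq_of_pow_dvd_add hab (Nat.not_dvd_of_pos_of_lt ha han)]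
  refine isMonochromaticAP_of_eq_succ fun i hi => ?_
  obtain ⟨m, hm⟩ : ∃ m, q ^ q = m + 2 := ⟨q ^ q - 2, by omega⟩
  have hm1 : q ^ q - 1 = m + 1 := by omega
  rw [hm1] at v1 ⊢
  rw [hm] at v2
  clear hm hm1 hqM1 hqM hM
  generalize q ^ n = Q at *
  have hB : (m + 1) * Q = m * Q + Q := by ring
  have hBq : q ∣ m * Q + Q := hB ▸ hqQ.mul_left _
  have hy : (m + 1) * Q - (q - 1) = m * Q + (Q - q) + 1 := by omega
  rw [hy]
  obtain ⟨R, rfl⟩ := Nat.exists_eq_add_of_lt hlt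
  rw [show q + R + 1 - q = R + 1 by omega]
  have hQ1 : q + R + 1 - 1 = q + R := by omega
  rw [hQ1] at hstep ⊢
  rcases lt_or_ge i q with hiq | hiq
  · obtain ⟨k, rfl⟩ := Nat.exists_eq_add_of_lt hiq
    refine hstep _ k (m * (i + k + 1 + R + 1) + (R + 1) + 1 + i) (by omega) ?_ ?_
    · rw [show i + k + 1 - 1 = i + k by omega]; ring
    · intro hk
      rw [padicValNat_cast_eq_zero (Nat.not_dvd_of_pos_of_lt hk (by omega))]
      rcases Nat.lt_or_ge 1 k with hk1 | hk1
      · exact (vz' _ (k - 1) (by convert hBq using 1; omega) (by omega) (by omega)).symm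
      · obtain rfl : k = 1 := by omega
        rw [← v1]; congr 2; ring
  obtain ⟨j, rfl⟩ := Nat.exists_eq_add_of_le hiq
  -- Full middle pass, where `x + (y + 1) = q ^ q * q ^ n`; then the final short one.
  rcases lt_or_ge j (q + R + 1) with hj | hj
  · obtain ⟨k, hk⟩ := Nat.exists_eq_add_of_lt hj
    refine hstep _ k ((m + 1) * (q + R + 1) + j) (by omega) ?_ ?_
    · obtain ⟨p, rfl⟩ := Nat.exists_eq_add_of_lt hq
      rw [show 1 + p + 1 - 1 = p + 1 by omega]
      have hk' : k = p + 2 + R - j := by omega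
      zify [show j ≤ p + 2 + R by omega] at hk'
      zify
      rw [hk']
      ring
    · intro hk0
      apply vsum _ _ hk0 (by omega)
      refine ⟨m + 2, ?_⟩
      have : k + ((m + 1) * (q + R + 1) + j + 1) = (m + 1) * (q + R + 1) + (j + k + 1) := by ring
      rw [this, ← hk]
      ring
  · obtain ⟨j, rfl⟩ := Nat.exists_eq_add_of_le hj
    refine hstep _ (q + R - j) ((m + 1) * (q + R + 1) + (q + R) + j) (by omega) ?_ ?_
    · obtain ⟨p, rfl⟩ := Nat.exists_eq_add_of_lt hq
      rw [show 1 + p + 1 - 1 = p + 1 by omega]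
      zify [show j ≤ 1 + p + 1 + R by omega]
      ring
    · intro _
      have hz : (padicValNat q (q + R - j) : ZMod q) = 0 :=
        vz' _ (j + 1) (by convert hqQ using 1; omega) (by omega) (by omega)
      rw [hz]
      rcases Nat.eq_zero_or_pos j with rfl | hj0
      · rw [← v2]; congr 2; ring
      · rw [show (m + 1) * (q + R + 1) + (q + R) + j + 1 = (m + 2) * (q + R + 1) + j by ring]
        exact (vz _ j (hqQ.mul_left _) hj0 (by omega)).symm

end Progressions

theorem exists_isMonochromaticAP_apBound {q : ℕ} [Fact q.Prime] {n : ℕ} (hn : 1 ≤ n) :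
    ∃ c, 1 ≤ c ∧ IsMonochromaticAP (genThueMorse q) c (q ^ n - 1) (apBound q n) := by
  have hq : 1 < q := (Fact.out : q.Prime).one_lt
  have h1 : 1 < q ^ n := Nat.one_lt_pow (by omega) hq
  unfold apBound
  split_ifs with h
  · exact ⟨_, by omega, isMonochromaticAP_pow_add_two_mul hn ((Nat.modEq_zero_iff_dvd).1 h)⟩
  · exact ⟨_, by omega, isMonochromaticAP_pow_sub_one n⟩

theorem theorem1 (q : ℕ) (hq : q.Prime) (n : ℕ) (hn : 1 ≤ n) :
    IsGreatest (maxAPLength (genThueMorse q) '' {d : ℕ | 1 ≤ d ∧ d < q ^ n}) (apBound q n : ℕ∞) ∧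
      maxAPLength (genThueMorse q) (q ^ n - 1) = (apBound q n : ℕ∞) ∧
      ∃ c : ℕ, 1 ≤ c ∧ apLengthFrom (genThueMorse q) c (q ^ n - 1) = (apBound q n : ℕ∞) := by
  have : Fact q.Prime := ⟨hq⟩
  have h1 : 1 < q ^ n := Nat.one_lt_pow (by omega) hq.one_lt
  have upper : ∀ c d, 1 ≤ d → d < q ^ n →
      apLengthFrom (genThueMorse q) c d ≤ (apBound q n : ℕ∞) := fun c d hd hdn =>
    iSup₂_le fun l hl => Nat.cast_le.2 (hl.le_apBound hn hd hdn)
  obtain ⟨c, hc, hmono⟩ := exists_isMonochromaticAP_apBound (q := q) hn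
  have hcl : apLengthFrom (genThueMorse q) c (q ^ n - 1) = (apBound q n : ℕ∞) :=
    le_antisymm (upper c _ (by omega) (by omega))
      (le_iSup₂_of_le (apBound q n) hmono le_rfl)
  have hmax : maxAPLength (genThueMorse q) (q ^ n - 1) = (apBound q n : ℕ∞) :=
    le_antisymm (iSup_le fun c => upper c _ (by omega) (by omega))
      (hcl.ge.trans (le_iSup (fun c => apLengthFrom (genThueMorse q) c (q ^ n - 1)) c))
  refine ⟨⟨⟨q ^ n - 1, ⟨by omega, by omega⟩, hmax⟩, ?_⟩, hmax, c, hc, hcl⟩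
  rintro _ ⟨d, ⟨hd, hdn⟩, rfl⟩
  exact iSup_le fun c => upper c d hd hdn
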